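/- Let $r\in\mathbb N$, $V=\mathbb R^r$, and for $\alpha\in V^*$ write $\alpha^\perp=\ker\alpha$. Let $\mathcal A=\{H_1,\dots,H_n\}$ be a simplicial arrangement in $V$, i.e. a finite set of distinct linear hyperplanes such that every connected component (chamber) of $V\setminus\bigcup_{H\in\mathcal A}H$ is an open simplicial cone $\{\sum_{i=1}^r a_i v_i \mid a_i>0 \text{ for all } i\}$ for some basis $v_1,\dots,v_r$ of $V$. For each $i$ choose $x_i\in V^*$ with $x_i^\perp=H_i$, and let $R=\{\pm x_1,\dots,\pm x_n\}$. For a chamber $K$ let \[ W^K=\{H\in\mathcal A \mid \dim(H\cap\overline K)=r-1\},\qquad B^K=\{\alpha\in R \mid \alpha^\perp\in W^K,\ \alpha\ge 0 \text{ on } K\},\qquad R^K_+=R\cap\sum_{\alpha\in B^K}\mathbb R_{\ge 0}\,\alpha, \] where $\overline K$ is the closure of $K$ and the dimension of a cone is that of its linear span. Call $(\mathcal A,R)$ crystallographic if $R\subseteq\sum_{\alpha\in B^K}\mathbb Z\alpha$ for every chamber $K$, and additive if for every chamber $K$ and every $\alpha\in R^K_+\setminus B^K$ there exist $\beta,\gamma\in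 R^K_+$ with $\alpha=\beta+\gamma$. Then $(\mathcal A,R)$ is crystallographic if and only if it is additive. -/

import Mathlib

namespace Arrangement

/-- The complement in `ℝ^r` of the union of the hyperplanes in `A`. -/
def complement {r : ℕ} (A : Set (Submodule ℝ (Fin r → ℝ))) : Set (Fin r → ℝ) :=
  (⋃ H ∈ A, (H : Set (Fin r → ℝ)))ᶜ

/-- The chambers: the connected components of the complement of the union of the hyperplanes. -/
def chambers {r : ℕ} (A : Set (Submodule ℝ (Fin r → ℝ))) : Set (Set (Fin r → ℝ)) :=
  {K | ∃ v ∈ complement A, K = connectedComponentIn (complement A) v}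

/-- `K` is the set of all positive linear combinations of some basis of `ℝ^r`. -/
def IsOpenSimplicialCone {r : ℕ} (K : Set (Fin r → ℝ)) : Prop :=
  ∃ b : Module.Basis (Fin r) ℝ (Fin r → ℝ),
    K = {v | ∃ a : Fin r → ℝ, (∀ i, 0 < a i) ∧ v = ∑ i, a i • b i}

/-- A simplicial arrangement: a finite set of linear hyperplanes all of whose chambers are open
simplicial cones. -/
structure IsSimplicial {r : ℕ} (A : Set (Submodule ℝ (Fin r → ℝ))) : Prop where
  finite : A.Finite
  hyperplane : ∀ H ∈ A, Module.finrank ℝ H + 1 = r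
  simplicial : ∀ K ∈ chambers A, IsOpenSimplicialCone K

/-- `R = {± x_H | H ∈ A}` for some choice of linear forms `x_H` with kernel `H`, one for each
`H ∈ A`. -/
def IsRootSet {r : ℕ} (A : Set (Submodule ℝ (Fin r → ℝ)))
    (R : Set (Module.Dual ℝ (Fin r → ℝ))) : Prop :=
  ∃ x : Submodule ℝ (Fin r → ℝ) → Module.Dual ℝ (Fin r → ℝ),
    (∀ H ∈ A, LinearMap.ker (x H) = H) ∧ R = {α | ∃ H ∈ A, α = x H ∨ α = -x H}

/-- The closed half-space `N(α)` on which `α` is nonnegative. -/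
def halfSpace {r : ℕ} (α : Module.Dual ℝ (Fin r → ℝ)) : Set (Fin r → ℝ) :=
  {v | 0 ≤ α v}

/-- The walls `W^K`: hyperplanes `H ∈ A` with `dim (H ∩ closure K) = r - 1`. The dimension of the
cone `H ∩ closure K` is the dimension of its linear span. -/
def walls {r : ℕ} (A : Set (Submodule ℝ (Fin r → ℝ))) (K : Set (Fin r → ℝ)) :
    Set (Submodule ℝ (Fin r → ℝ)) :=
  {H | H ∈ A ∧
    Module.finrank ℝ (Submodule.span ℝ ((H : Set (Fin r → ℝ)) ∩ closure K)) + 1 = r}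

/-- `B^K`: the elements of `R` that are normal to a wall of `K` and point to the inside. -/
def simpleRoots {r : ℕ} (A : Set (Submodule ℝ (Fin r → ℝ)))
    (R : Set (Module.Dual ℝ (Fin r → ℝ))) (K : Set (Fin r → ℝ)) :
    Set (Module.Dual ℝ (Fin r → ℝ)) :=
  {α | α ∈ R ∧ LinearMap.ker α ∈ walls A K ∧ halfSpace α ∩ K = K}

/-- `R^K_+`: the elements of `R` that are nonnegative real combinations of `B^K`. -/
def positiveRoots {r : ℕ} (A : Set (Submodule ℝ (Fin r → ℝ)))
    (R : Set (Module.Dual ℝ (Fin r → ℝ))) (K : Set (Fin r → ℝ)) :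
    Set (Module.Dual ℝ (Fin r → ℝ)) :=
  R ∩ (Submodule.span NNReal (simpleRoots A R K) : Set (Module.Dual ℝ (Fin r → ℝ)))

/-- Every element of `R` is an integer combination of `B^K`, for every chamber `K`. -/
def IsCrystallographic {r : ℕ} (A : Set (Submodule ℝ (Fin r → ℝ)))
    (R : Set (Module.Dual ℝ (Fin r → ℝ))) : Prop :=
  ∀ K ∈ chambers A,
    R ⊆ (Submodule.span ℤ (simpleRoots A R K) : Set (Module.Dual ℝ (Fin r → ℝ)))

/-- For every chamber `K`, every element of `R^K_+` outside `B^K` is a sum of two elements of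
`R^K_+`. -/
def IsAdditive {r : ℕ} (A : Set (Submodule ℝ (Fin r → ℝ)))
    (R : Set (Module.Dual ℝ (Fin r → ℝ))) : Prop :=
  ∀ K ∈ chambers A, ∀ α ∈ positiveRoots A R K \ simpleRoots A R K,
    ∃ β ∈ positiveRoots A R K, ∃ γ ∈ positiveRoots A R K, α = β + γ

end Arrangement

/-! Positivity at one point of a chamber decides which roots are positive, and the simple roots are
the coordinate forms of a basis spanning the chamber. Additivity thus gives integrality by induction
on the value of a positive root at a point of the chamber: both summands have smaller values.

For the converse, fix a chamber $K_0$ and a positive root α that is not simple for it. Some chamber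
has α as a simple root (`exists_coord_eq`). Walk from there towards $K_0$, crossing codimension-two
faces of the current chamber that lie in the hyperplane of α. If α stays simple at each crossing,
fewer roots separate the new chamber from $K_0$, so the walk would end in $K_0$, where α is not
simple. Hence at some face α is a positive integral combination of two simple roots β, γ of a
chamber around that face, and β, γ are positive on $K_0$.

There the problem has rank two. With α = aβ + bγ and a, b > 0, the sum β + γ must be a root, since
otherwise a chamber between their hyperplanes would have a base contradicting integrality
(`add_mem_of_dual_pair`). Subtractive Euclid on (a, b) then writes α as a sum of two positive roots
(`exists_add_of_dual_pair`). -/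

namespace Arrangement

open Module

/-! ### Integral systems of linear forms -/

section Abstract

variable {V ι : Type*} [AddCommGroup V] [Module ℝ V] [Fintype ι]

/-- `e` is the basis of `V` dual to a base of `R` that is positive at `v`: its coordinate forms lie
in `R` and are positive at `v`, and all forms in `R` that are positive at `v` are combinations of
them with natural number coefficients. -/
structure IsDualBase (R : Set (Dual ℝ V)) (v : V) (e : Basis ι ℝ V) : Prop where
  coord_mem : ∀ i, e.coord i ∈ R
  coord_pos : ∀ i, 0 < e.coord i v
  exists_nat : ∀ ρ ∈ R, 0 < ρ v → ∀ i, ∃ n : ℕ, ρ (e i) = n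

/-- A finite, symmetric, reduced set of nonzero linear forms that has an integral base at every
point off its hyperplanes. -/
structure IsIntegralSystem (ι : Type*) [Fintype ι] (R : Set (Dual ℝ V)) : Prop where
  finite : R.Finite
  neg_mem : ∀ ρ ∈ R, -ρ ∈ R
  zero_notMem : (0 : Dual ℝ V) ∉ R
  reduced : ∀ ρ ∈ R, ∀ c : ℝ, c • ρ ∈ R → c = 1 ∨ c = -1
  exists_dualBase : ∀ v : V, (∀ ρ ∈ R, ρ v ≠ 0) → ∃ e : Basis ι ℝ V, IsDualBase R v e

theorem apply_eq_sum_coord (e : Basis ι ℝ V) (ρ : Dual ℝ V) (x : V) :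
    ρ x = ∑ i, ρ (e i) * e.coord i x := by
  conv_lhs => rw [← e.sum_dual_apply_smul_coord ρ]
  simp only [LinearMap.sum_apply, LinearMap.smul_apply, smul_eq_mul]

theorem eq_smul_coord {V ι : Type*} [AddCommGroup V] [Module ℝ V] (e : Basis ι ℝ V)
    {ρ : Dual ℝ V} {i : ι} (h : ∀ j, j ≠ i → ρ (e j) = 0) :
    ρ = ρ (e i) • e.coord i := by
  classical
  refine e.ext fun j ↦ ?_
  by_cases hj : j = i
  · subst hj; simp
  · simp [h j hj, hj]

theorem IsDualBase.apply_nonneg {R : Set (Dual ℝ V)} {v : V} {e : Basis ι ℝ V}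
    (he : IsDualBase R v e) {w : V} (hw : ∀ i, 0 ≤ e.coord i w) {ρ : Dual ℝ V} (hρ : ρ ∈ R)
    (hρv : 0 < ρ v) : 0 ≤ ρ w := by
  rw [apply_eq_sum_coord e]
  refine Finset.sum_nonneg fun i _ ↦ ?_
  obtain ⟨n, hn⟩ := he.exists_nat ρ hρ hρv i
  rw [hn]
  exact mul_nonneg (by positivity) (hw i)

namespace IsIntegralSystem

variable {R : Set (Dual ℝ V)}

theorem exists_int (hR : IsIntegralSystem ι R)
    {v : V} {e : Basis ι ℝ V} (hv : ∀ ρ ∈ R, ρ v ≠ 0) (he : IsDualBase R v e)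
    {ρ : Dual ℝ V} (hρ : ρ ∈ R) (i : ι) : ∃ n : ℤ, ρ (e i) = n := by
  rcases lt_or_gt_of_ne (hv ρ hρ) with h | h
  · obtain ⟨n, hn⟩ := he.exists_nat (-ρ) (hR.neg_mem ρ hρ) (by simpa using h) i
    refine ⟨-n, ?_⟩
    simp only [LinearMap.neg_apply] at hn
    push_cast
    linarith
  · obtain ⟨n, hn⟩ := he.exists_nat ρ hρ h i
    exact ⟨n, by simpa using hn⟩

/-- Points in direction `u` from `x` and close to `x` lie on the same side as `x` of all
hyperplanes that do not contain `x`. -/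
theorem exists_perturbation {x u : V} (hu : ∀ ρ ∈ R, ρ x = 0 → ρ u ≠ 0) (hfin : R.Finite)
    (hneg : ∀ ρ ∈ R, -ρ ∈ R) :
    ∃ v : V, (∀ ρ ∈ R, ρ v ≠ 0) ∧ (∀ ρ ∈ R, 0 < ρ x → 0 < ρ v) ∧
      (∀ ρ ∈ R, ρ x = 0 → (0 < ρ v ↔ 0 < ρ u)) := by
  have key : ∀ᶠ t : ℝ in nhdsWithin 0 (Set.Ioi 0), ∀ ρ ∈ R, 0 < ρ x → 0 < ρ (x + t • u) := by
    rw [Filter.eventually_all_finite hfin]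
    intro ρ _
    by_cases hx : 0 < ρ x
    · have : Filter.Tendsto (fun t : ℝ ↦ ρ (x + t • u)) (nhdsWithin 0 (Set.Ioi 0))
          (nhds (ρ x)) := by
        have hc : Continuous fun t : ℝ ↦ ρ x + t * ρ u := by fun_prop
        have := hc.tendsto 0
        simp only [zero_mul, add_zero] at this
        simpa using this.mono_left nhdsWithin_le_nhds
      filter_upwards [this.eventually (lt_mem_nhds hx)] with t ht _ using ht
    · exact Filter.Eventually.of_forall fun t h ↦ absurd h hx
  obtain ⟨t, ht, ht0⟩ := (key.and self_mem_nhdsWithin).exists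
  have ht0 : 0 < t := ht0
  refine ⟨x + t • u, fun ρ hρ ↦ ?_, ht, fun ρ hρ hx ↦ by simp [hx, ht0]⟩
  rcases lt_trichotomy (ρ x) 0 with h | h | h
  · have := ht (-ρ) (hneg ρ hρ) (by simpa using h)
    rw [LinearMap.neg_apply] at this
    linarith
  · simp [h, ht0.ne', hu ρ hρ h]
  · exact (ht ρ hρ h).ne'

theorem coord_nonneg (hR : IsIntegralSystem ι R)
    {x v : V} {e : Basis ι ℝ V} (he : IsDualBase R v e)
    (hxv : ∀ ρ ∈ R, 0 < ρ x → 0 < ρ v) (i : ι) : 0 ≤ e.coord i x := by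
  by_contra! h
  have := hxv (-e.coord i) (hR.neg_mem _ (he.coord_mem i)) (by simpa using h)
  have h2 := he.coord_pos i
  rw [LinearMap.neg_apply] at this
  linarith

/-- A form in `R` vanishing at `x` is a combination of those elements of a base at a point near `x`
that vanish at `x`. -/
theorem apply_eq_zero_or_coord_eq_zero (hR : IsIntegralSystem ι R)
    {x v : V} {e : Basis ι ℝ V} (hv : ∀ ρ ∈ R, ρ v ≠ 0)
    (he : IsDualBase R v e) (hxv : ∀ ρ ∈ R, 0 < ρ x → 0 < ρ v) {ρ : Dual ℝ V} (hρ : ρ ∈ R)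
    (hx : ρ x = 0) (i : ι) : ρ (e i) = 0 ∨ e.coord i x = 0 := by
  wlog hpos : 0 < ρ v generalizing ρ
  · have := this (ρ := -ρ) (hR.neg_mem ρ hρ) (by simp [hx])
      (by simpa using lt_of_le_of_ne (not_lt.1 hpos) (hv ρ hρ))
    simpa using this
  rw [apply_eq_sum_coord e, Finset.sum_eq_zero_iff_of_nonneg] at hx
  · exact mul_eq_zero.1 (hx i (Finset.mem_univ i))
  · intro j _
    obtain ⟨n, hn⟩ := he.exists_nat ρ hρ hpos j
    have := hR.coord_nonneg he hxv j
    rw [hn]; positivity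

/-- Every element of `R` belongs to a base at some point. -/
theorem exists_coord_eq (hR : IsIntegralSystem ι R) {α : Dual ℝ V} (hα : α ∈ R) :
    ∃ v : V, (∀ ρ ∈ R, ρ v ≠ 0) ∧ ∃ e : Basis ι ℝ V, IsDualBase R v e ∧ ∃ i, e.coord i = α := by
  have hα0 : α ≠ 0 := fun h ↦ hR.zero_notMem (h ▸ hα)
  obtain ⟨u, hu⟩ : ∃ u, 0 < α u := by
    obtain ⟨u, hu⟩ := DFunLike.ne_iff.1 hα0
    rw [LinearMap.zero_apply] at hu
    rcases lt_or_gt_of_ne hu with h | h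
    · exact ⟨-u, by simpa using h⟩
    · exact ⟨u, h⟩
  have : Finite {ρ // ρ ∈ R ∧ ρ ≠ α ∧ ρ ≠ -α} := (hR.finite.subset fun ρ h ↦ h.1).to_subtype
  -- A generic point of the hyperplane of α: a root vanishing on all of `ker α` is a multiple of α,
  -- hence ±α by reducedness.
  obtain ⟨x, hx, hxρ⟩ := Module.Dual.exists_forall_mem_ne_zero_of_forall_exists
    (LinearMap.ker α) (fun ρ : {ρ // ρ ∈ R ∧ ρ ≠ α ∧ ρ ≠ -α} ↦ (ρ : Dual ℝ V)) (by
      rintro ⟨ρ, hρ, h1, h2⟩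
      by_contra! h
      have hρα : ρ = (ρ u / α u) • α := by
        ext y
        have h3 := h (y - (α y / α u) • u) (by simp [hu.ne'])
        simp only [map_sub, map_smul, smul_eq_mul] at h3
        simp only [LinearMap.smul_apply, smul_eq_mul]
        rw [sub_eq_zero.1 h3]; ring
      rcases hR.reduced α hα _ (hρα ▸ hρ) with h3 | h3
      · exact h1 (hρα.trans (by rw [h3, one_smul]))
      · exact h2 (hρα.trans (by ext y; simp [h3])))
  have hpm : ∀ ρ ∈ R, ρ x = 0 → ρ = α ∨ ρ = -α := by
    intro ρ hρ h
    by_contra! h'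
    exact hxρ ⟨ρ, hρ, h'⟩ h
  obtain ⟨v, hv, hxv, huv⟩ := exists_perturbation (R := R) (x := x) (u := u) (by
    intro ρ hρ h
    rcases hpm ρ hρ h with rfl | rfl
    · exact hu.ne'
    · simpa using hu.ne') hR.finite hR.neg_mem
  obtain ⟨e, he⟩ := hR.exists_dualBase v hv
  refine ⟨v, hv, e, he, ?_⟩
  have hxα : α x = 0 := hx
  obtain ⟨i, hi⟩ : ∃ i, α (e i) ≠ 0 := by
    by_contra! h
    exact hα0 (e.ext fun i ↦ by simp [h i])
  have hix := (hR.apply_eq_zero_or_coord_eq_zero hv he hxv hα hxα i).resolve_left hi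
  refine ⟨i, (hpm _ (he.coord_mem i) hix).resolve_right fun h ↦ ?_⟩
  have h1 := he.coord_pos i
  have h2 := (huv α hα hxα).2 hu
  rw [h, LinearMap.neg_apply] at h1
  linarith

/-! ### Rank two -/

/-- If β + γ were not a root, its kernel would meet a chamber near `x` on which β > 0 > γ.
Unimodularity of the base there forces α to have coefficients of both signs. -/
theorem add_mem_of_dual_pair (hR : IsIntegralSystem ι R)
    {x : V} {α β γ : Dual ℝ V} {p q : V} {a b : ℕ} (ha : 0 < a)
    (hb : 0 < b) (hα : α ∈ R) (hβ : β ∈ R) (hγ : γ ∈ R) (hβx : β x = 0) (hγx : γ x = 0)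
    (hβp : β p = 1) (hβq : β q = 0) (hγp : γ p = 0) (hγq : γ q = 1)
    (hcomb : ∀ ρ ∈ R, ρ x = 0 → ∃ m n : ℤ, ρ = (m : ℝ) • β + (n : ℝ) • γ)
    (hαeq : α = (a : ℝ) • β + (b : ℝ) • γ) : β + γ ∈ R := by
  by_contra hnot
  -- β + γ vanishes at `p - q`. A root through `x` vanishing there too is m(β + γ); since every root
  -- is a base element somewhere, it takes the value 1 where β and γ are integers, so m = ±1.
  obtain ⟨v, hv, hxv, huv⟩ := exists_perturbation (R := R) (x := x) (u := p - q) (by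
    intro ρ hρ hρx hy
    obtain ⟨m, n, hmn⟩ := hcomb ρ hρ hρx
    have hmn' : (m : ℝ) = n := by
      rw [hmn] at hy
      simp only [LinearMap.add_apply, LinearMap.smul_apply, map_sub, hβp, hβq, hγp, hγq,
        smul_eq_mul] at hy
      linarith
    have hρeq : ρ = (m : ℝ) • (β + γ) := by rw [hmn, ← hmn', smul_add]
    obtain ⟨w, hw, e, he, i, hi⟩ := hR.exists_coord_eq hρ
    obtain ⟨k, hk⟩ := hR.exists_int hw he hβ i
    obtain ⟨l, hl⟩ := hR.exists_int hw he hγ i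
    have h1 : ρ (e i) = 1 := by rw [← hi]; simp
    rw [hρeq, LinearMap.smul_apply, LinearMap.add_apply, hk, hl, smul_eq_mul] at h1
    have h2 : m * (k + l) = 1 := by exact_mod_cast h1
    rcases Int.eq_one_or_neg_one_of_mul_eq_one h2 with h3 | h3
    · apply hnot
      rw [hρeq, h3] at hρ
      simpa using hρ
    · apply hnot
      have := hR.neg_mem ρ hρ
      rw [hρeq, h3] at this
      simpa [add_comm] using this) hR.finite hR.neg_mem
  obtain ⟨e, he⟩ := hR.exists_dualBase v hv
  have hβv : 0 < β v := (huv β hβ hβx).2 (by simp [hβp, hβq])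
  have hγv : 0 < (-γ) v := (huv (-γ) (hR.neg_mem γ hγ) (by simp [hγx])).2 (by simp [hγp, hγq])
  choose s hs using he.exists_nat β hβ hβv
  choose t ht' using he.exists_nat (-γ) (hR.neg_mem γ hγ) hγv
  have ht : ∀ i, γ (e i) = -(t i : ℝ) := fun i ↦ by
    have := ht' i
    rw [LinearMap.neg_apply] at this
    linarith
  have hpos : ∀ i, s i ≠ t i → e.coord i x = 0 ∧ 0 < e.coord i (p - q) := by
    intro i hi
    have : e.coord i x = 0 := by
      by_cases h : s i = 0
      · refine (hR.apply_eq_zero_or_coord_eq_zero hv he hxv hγ hγx i).resolve_left fun h' ↦ ?_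
        rw [ht] at h'
        have : t i = 0 := by exact_mod_cast neg_eq_zero.1 h'
        omega
      · refine (hR.apply_eq_zero_or_coord_eq_zero hv he hxv hβ hβx i).resolve_left fun h' ↦ ?_
        rw [hs] at h'
        exact h (by exact_mod_cast h')
    exact ⟨this, (huv _ (he.coord_mem i) this).1 (he.coord_pos i)⟩
  have hsum : ∑ i, ((s i : ℝ) - t i) * e.coord i (p - q) = 0 := by
    have : (β + γ) (p - q) = 0 := by simp [hβp, hβq, hγp, hγq]
    rw [apply_eq_sum_coord e] at this
    rw [← this]
    refine Finset.sum_congr rfl fun i _ ↦ ?_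
    rw [LinearMap.add_apply, hs, ht, sub_eq_add_neg]
  have hterm : ∃ i, ((s i : ℝ) - t i) * e.coord i (p - q) ≠ 0 := by
    by_contra! h
    have h0 : β + γ = 0 := e.ext fun i ↦ by
      rw [LinearMap.add_apply, hs, ht, LinearMap.zero_apply]
      by_cases hi : s i = t i
      · simp [hi]
      · have := (mul_eq_zero.1 (h i)).resolve_right (hpos i hi).2.ne'
        linarith
    have := congrArg (fun f ↦ f p) h0
    simp [hβp, hγp] at this
  -- The terms sum to zero without all vanishing, so both signs occur; they are the signs of `s i -
  -- t i`, the coefficients of β + γ.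
  obtain ⟨n, -, hn⟩ : ∃ n ∈ Finset.univ, 0 < ((s n : ℝ) - t n) * e.coord n (p - q) :=
    Finset.exists_pos_of_sum_zero_of_exists_nonzero _ hsum
      (by obtain ⟨i, hi⟩ := hterm; exact ⟨i, Finset.mem_univ i, hi⟩)
  obtain ⟨m, -, hm⟩ : ∃ m ∈ Finset.univ, 0 < -(((s m : ℝ) - t m) * e.coord m (p - q)) :=
    Finset.exists_pos_of_sum_zero_of_exists_nonzero _
      (by rw [Finset.sum_neg_distrib, hsum, neg_zero])
      (by obtain ⟨i, hi⟩ := hterm; exact ⟨i, Finset.mem_univ i, neg_ne_zero.2 hi⟩)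
  have hn' : s n ≠ t n := by rintro h; simp [h] at hn
  have hm' : s m ≠ t m := by rintro h; simp [h] at hm
  have hnlt : t n < s n := by
    have := pos_of_mul_pos_left hn (hpos n hn').2.le
    exact_mod_cast sub_pos.1 this
  have hmlt : s m < t m := by
    rw [← neg_mul] at hm
    have := pos_of_mul_pos_left hm (hpos m hm').2.le
    have : (s m : ℝ) < t m := by linarith
    exact_mod_cast this
  have hnm : n ≠ m := by rintro rfl; omega
  obtain ⟨i, j, hij⟩ := hcomb _ (he.coord_mem n) (hpos n hn').1
  obtain ⟨k, l, hkl⟩ := hcomb _ (he.coord_mem m) (hpos m hm').1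
  have e1 := congrArg (fun f ↦ f (e n)) hij
  have e2 := congrArg (fun f ↦ f (e m)) hij
  have e3 := congrArg (fun f ↦ f (e n)) hkl
  have e4 := congrArg (fun f ↦ f (e m)) hkl
  simp only [Basis.coord_apply, Basis.repr_self, Finsupp.single_eq_same, LinearMap.add_apply,
    LinearMap.smul_apply, hs, ht, smul_eq_mul, Finsupp.single_eq_of_ne hnm,
    Finsupp.single_eq_of_ne hnm.symm] at e1 e2 e3 e4
  have e1 : (1 : ℤ) = i * s n + j * (-t n) := by exact_mod_cast e1
  have e2 : (0 : ℤ) = i * s m + j * (-t m) := by exact_mod_cast e2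
  have e3 : (0 : ℤ) = k * s n + l * (-t n) := by exact_mod_cast e3
  have e4 : (1 : ℤ) = k * s m + l * (-t m) := by exact_mod_cast e4
  -- The two base elements and β, γ are related by mutually inverse integer matrices, so the
  -- determinant is a unit; the next bound leaves only `t n = s m = 0`.
  have hdet : ((s n : ℤ) * t m - s m * t n) * (j * k - i * l) = 1 := by
    linear_combination -(k * s m - l * t m) * e1 + (k * s n - l * t n) * e2 - e4
  have hge : (1 : ℤ) + t n + s m ≤ s n * t m - s m * t n := by
    have h1 : (t n : ℤ) + 1 ≤ s n := by exact_mod_cast hnlt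
    have h2 : (s m : ℤ) + 1 ≤ t m := by exact_mod_cast hmlt
    nlinarith [mul_le_mul h1 h2 (by positivity) (by positivity)]
  have htn : t n = 0 ∧ s m = 0 := by
    rcases Int.eq_one_or_neg_one_of_mul_eq_one hdet with h | h <;> omega
  have hαn : 0 < α (e n) := by
    rw [hαeq, LinearMap.add_apply, LinearMap.smul_apply, LinearMap.smul_apply, hs, ht, htn.1]
    have : 0 < s n := by omega
    simp only [smul_eq_mul, Nat.cast_zero, neg_zero, mul_zero, add_zero]
    positivity
  have hαm : α (e m) < 0 := by
    rw [hαeq, LinearMap.add_apply, LinearMap.smul_apply, LinearMap.smul_apply, hs, ht, htn.2]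
    have : 0 < t m := by omega
    have : (0 : ℝ) < b * t m := by positivity
    simp only [smul_eq_mul, Nat.cast_zero, mul_zero, zero_add]
    linarith
  rcases lt_or_gt_of_ne (hv α hα) with h | h
  · obtain ⟨N, hN⟩ := he.exists_nat (-α) (hR.neg_mem α hα) (by simpa using h) n
    rw [LinearMap.neg_apply] at hN
    have : (0 : ℝ) ≤ N := by positivity
    linarith
  · obtain ⟨N, hN⟩ := he.exists_nat α hα h m
    have : (0 : ℝ) ≤ N := by positivity
    linarith

/-- Subtractive Euclid: the form with the larger coefficient stays and the other becomes β + γ,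
while `p`, `q` change so as to remain dual to the pair. When a = b, reducedness forces a = 1. -/
theorem exists_add_of_dual_pair (hR : IsIntegralSystem ι R)
    {x v : V} {α : Dual ℝ V} (hα : α ∈ R) :
    ∀ (N : ℕ) {β γ : Dual ℝ V} {p q : V} {a b : ℕ}, a + b = N → 0 < a → 0 < b → β ∈ R → γ ∈ R →
    β x = 0 → γ x = 0 → 0 < β v → 0 < γ v → β p = 1 → β q = 0 → γ p = 0 → γ q = 1 →
    (∀ ρ ∈ R, ρ x = 0 → ∃ m n : ℤ, ρ = (m : ℝ) • β + (n : ℝ) • γ) →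
    α = (a : ℝ) • β + (b : ℝ) • γ →
    ∃ β' ∈ R, 0 < β' v ∧ ∃ γ' ∈ R, 0 < γ' v ∧ α = β' + γ' := by
  intro N
  induction N using Nat.strong_induction_on with
  | _ N ih =>
  intro β γ p q a b hN ha hb hβ hγ hβx hγx hβv hγv hβp hβq hγp hγq hcomb hαeq
  have hmem := hR.add_mem_of_dual_pair ha hb hα hβ hγ hβx hγx hβp hβq hγp hγq hcomb hαeq
  have hsv : 0 < (β + γ) v := by simpa using add_pos hβv hγv
  have hsx : (β + γ) x = 0 := by simp [hβx, hγx]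
  rcases lt_trichotomy a b with hab | hab | hab
  · refine ih b (by omega) (β := β + γ) (γ := γ) (p := p) (q := q - p) (a := a) (b := b - a)
      (by omega) ha (by omega) hmem hγ hsx hγx hsv hγv (by simp [hβp, hγp])
      (by simp [hβp, hβq, hγp, hγq]) hγp (by simp [hγp, hγq]) ?_ ?_
    · intro ρ hρ hρx
      obtain ⟨m, n, h⟩ := hcomb ρ hρ hρx
      refine ⟨m, n - m, ?_⟩
      rw [h]; push_cast; module
    · rw [hαeq, Nat.cast_sub hab.le]; module
  · subst hab
    have h : α = (a : ℝ) • (β + γ) := by rw [hαeq, smul_add]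
    have ha1 : (a : ℝ) = 1 := by
      refine (hR.reduced _ hmem a (h ▸ hα)).resolve_right fun h' ↦ ?_
      have : (0 : ℝ) < a := by positivity
      linarith
    exact ⟨β, hβ, hβv, γ, hγ, hγv, by rw [h, ha1, one_smul]⟩
  · refine ih a (by omega) (β := β) (γ := β + γ) (p := p - q) (q := q) (a := a - b) (b := b)
      (by omega) (by omega) hb hβ hmem hβx hsx hβv hsv (by simp [hβp, hβq]) hβq
      (by simp [hβp, hβq, hγp, hγq]) (by simp [hβq, hγq]) ?_ ?_
    · intro ρ hρ hρx
      obtain ⟨m, n, h⟩ := hcomb ρ hρ hρx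
      refine ⟨m - n, n, ?_⟩
      rw [h]; push_cast; module
    · rw [hαeq, Nat.cast_sub hab.le]; module

/-! ### Walking between chambers -/

/-- Two bases that are positive at a common point consist of the same forms. -/
theorem exists_coord_eq_of_coord_pos (hR : IsIntegralSystem ι R)
    {v w : V} {e f : Basis ι ℝ V} (hv : ∀ ρ ∈ R, ρ v ≠ 0)
    (he : IsDualBase R v e) (hf : IsDualBase R w f)
    (hew : ∀ i, 0 < e.coord i w) (k : ι) : ∃ i, f.coord i = e.coord k := by
  have hvw : ∀ ρ ∈ R, 0 < ρ w → 0 < ρ v := by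
    intro ρ hρ h
    by_contra h'
    have h1 := he.apply_nonneg (fun i ↦ (hew i).le) (hR.neg_mem ρ hρ)
      (by simpa using lt_of_le_of_ne (not_lt.1 h') (hv ρ hρ))
    rw [LinearMap.neg_apply] at h1
    linarith
  choose n hn using hf.exists_nat _ (he.coord_mem k) (hew k)
  have hm : ∀ i j, ∃ m : ℕ, f.coord i (e j) = m := fun i j ↦
    he.exists_nat _ (hf.coord_mem i) (hvw _ (hf.coord_mem i) (hf.coord_pos i)) j
  choose m hm using hm
  obtain ⟨i, hi⟩ : ∃ i, n i ≠ 0 := by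
    by_contra! h
    have : e.coord k = 0 := f.ext fun i ↦ by rw [hn, h]; simp
    exact hR.zero_notMem (this ▸ he.coord_mem k)
  refine ⟨i, ?_⟩
  -- All terms of the expansion of `e.coord k (e j) = 0` in `f` are nonnegative, so each `f.coord i`
  -- that occurs in `e.coord k` vanishes at `e j`.
  have h0 : ∀ j, j ≠ k → f.coord i (e j) = 0 := by
    intro j hj
    have h1 : e.coord k (e j) = 0 := by simp [Finsupp.single_eq_of_ne hj.symm]
    rw [apply_eq_sum_coord f, Finset.sum_eq_zero_iff_of_nonneg] at h1
    · refine (mul_eq_zero.1 (h1 i (Finset.mem_univ i))).resolve_left ?_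
      rw [hn]; exact_mod_cast hi
    · intro l _
      rw [hn, hm]; positivity
  have h1 := eq_smul_coord e h0
  have hc : f.coord i (e k) = 1 := by
    refine (hR.reduced _ (he.coord_mem k) _ (h1 ▸ hf.coord_mem i)).resolve_right fun h' ↦ ?_
    rw [hm] at h'
    have : (0 : ℝ) ≤ m i k := by positivity
    linarith
  rw [h1, hc, one_smul]

/-- Strong induction on the number `N` of roots separating `v` from `v₀`: either α remains simple in
a chamber nearer to `v₀`, or it decomposes in the rank-two system at the face being crossed. -/
theorem exists_coord_eq_or_exists_add_of_coord_eq (hR : IsIntegralSystem ι R) {v₀ : V}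
    {e₀ : Basis ι ℝ V} (hv₀ : ∀ ρ ∈ R, ρ v₀ ≠ 0) (he₀ : IsDualBase R v₀ e₀) {α : Dual ℝ V}
    (hα : α ∈ R) (hαv₀ : 0 < α v₀) :
    ∀ (N : ℕ) {v : V} {e : Basis ι ℝ V} {k : ι}, {ρ ∈ R | 0 < ρ v₀ ∧ ρ v < 0}.ncard = N →
    (∀ ρ ∈ R, ρ v ≠ 0) → IsDualBase R v e → e.coord k = α →
    (∃ i, e₀.coord i = α) ∨ ∃ β ∈ R, 0 < β v₀ ∧ ∃ γ ∈ R, 0 < γ v₀ ∧ α = β + γ := by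
  classical
  intro N
  induction N using Nat.strong_induction_on with
  | _ N ih =>
  intro v e k hN hv he hk
  by_cases hall : ∀ i, 0 < e.coord i v₀
  · exact .inl (hk ▸ hR.exists_coord_eq_of_coord_pos hv he he₀ hall k)
  push Not at hall
  obtain ⟨j, hj⟩ := hall
  have hjk : j ≠ k := by
    rintro rfl
    rw [hk] at hj
    exact absurd hαv₀ (not_lt.2 hj)
  have hj' : e.coord j v₀ < 0 := lt_of_le_of_ne hj (hv₀ _ (he.coord_mem j))
  -- A relative interior point of the codimension-two face cut out by α and a wall `j` that
  -- separates from `v₀`. Below, `w` lies near `x` in direction `v₀`, so roots through `x` have the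
  -- same sign at `w` as at `v₀`.
  obtain ⟨x, hx⟩ : ∃ x : V, ∀ i, e.coord i x = if i = j ∨ i = k then 0 else 1 :=
    ⟨e.equivFun.symm fun i ↦ if i = j ∨ i = k then 0 else 1, fun i ↦ by
      rw [Basis.coord_equivFun_symm]⟩
  have hx0 : ∀ i, 0 ≤ e.coord i x := fun i ↦ by rw [hx]; split_ifs <;> norm_num
  have hxv : ∀ ρ ∈ R, 0 < ρ x → 0 < ρ v := by
    intro ρ hρ h
    by_contra h'
    have h1 := he.apply_nonneg hx0 (hR.neg_mem ρ hρ)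
      (by simpa using lt_of_le_of_ne (not_lt.1 h') (hv ρ hρ))
    rw [LinearMap.neg_apply] at h1
    linarith
  have hjx : e.coord j x = 0 := by simp [hx]
  have hαx : α x = 0 := by rw [← hk, hx]; simp
  obtain ⟨w, hw, hxw, hw₀⟩ := exists_perturbation (R := R) (x := x) (u := v₀)
    (fun ρ hρ _ ↦ hv₀ ρ hρ) hR.finite hR.neg_mem
  obtain ⟨f, hf⟩ := hR.exists_dualBase w hw
  by_cases hl : ∃ l, f.coord l = α
  · obtain ⟨l, hl⟩ := hl
    refine ih _ ?_ rfl hw hf hl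
    rw [← hN]
    -- No root through `x` separates `w` from `v₀`, and the others have equal signs at `v` and `w`;
    -- the inclusion is strict because `-e.coord j` drops out.
    refine Set.ncard_lt_ncard ⟨?_, ?_⟩ (hR.finite.subset fun ρ h ↦ h.1)
    · rintro ρ ⟨hρ, h1, h2⟩
      refine ⟨hρ, h1, ?_⟩
      have h3 : ρ x < 0 := by
        rcases lt_trichotomy (ρ x) 0 with h | h | h
        · exact h
        · exact absurd ((hw₀ ρ hρ h).2 h1) (not_lt.2 h2.le)
        · exact absurd (hxw ρ hρ h) (not_lt.2 h2.le)
      simpa using hxv (-ρ) (hR.neg_mem ρ hρ) (by simpa using h3)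
    · intro hsub
      have hmem := hR.neg_mem _ (he.coord_mem j)
      have h1 := (hsub (a := -e.coord j) ⟨hmem, by simpa using hj', by
        simpa using he.coord_pos j⟩).2.2
      have h2 := (hw₀ _ hmem (by rw [LinearMap.neg_apply, hjx, neg_zero])).2 (by simpa using hj')
      exact lt_asymm h1 h2
  right
  have hαw : 0 < α w := (hw₀ α hα hαx).2 hαv₀
  choose n hn using hf.exists_nat α hα hαw
  obtain ⟨l, hnl⟩ : ∃ l, n l ≠ 0 := by
    by_contra! h
    have : α = 0 := f.ext fun i ↦ by rw [hn, h]; simp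
    exact hR.zero_notMem (this ▸ hα)
  -- With a single nonzero coefficient, reducedness would make α a base element at `w`.
  obtain ⟨m, hml, hnm⟩ : ∃ m, m ≠ l ∧ n m ≠ 0 := by
    by_contra! h
    have h1 : α = α (f l) • f.coord l := eq_smul_coord f fun i hi ↦ by rw [hn, h i hi]; simp
    have h2 : α (f l) = 1 := by
      refine (hR.reduced _ (hf.coord_mem l) _ (h1 ▸ hα)).resolve_right fun h' ↦ ?_
      rw [hn] at h'
      have : (0 : ℝ) ≤ n l := by positivity
      linarith
    exact hl ⟨l, by rw [h1, h2, one_smul]⟩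
  have hvan : ∀ i, n i ≠ 0 → f.coord i x = 0 := fun i hi ↦
    (hR.apply_eq_zero_or_coord_eq_zero hw hf hxw hα hαx i).resolve_left (by
      rw [hn]; exact_mod_cast hi)
  have hplane : ∀ ρ ∈ R, ρ x = 0 → ρ = ρ (e k) • e.coord k + ρ (e j) • e.coord j := by
    intro ρ hρ hρx
    refine e.ext fun i ↦ ?_
    by_cases hi : i = k
    · subst hi; simp [Finsupp.single_eq_of_ne hjk]
    by_cases hi' : i = j
    · subst hi'; simp [Finsupp.single_eq_of_ne hjk.symm]
    have := (hR.apply_eq_zero_or_coord_eq_zero hv he hxv hρ hρx i).resolve_right (by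
      rw [hx, if_neg (by tauto)]; norm_num)
    simp [this, hi, hi']
  have honly : ∀ i, f.coord i x = 0 → i = l ∨ i = m := by
    intro i hi
    by_contra! hne
    -- Roots through `x` span at most a plane. The relation among three such forms with 2×2 minors
    -- as coefficients contradicts the independence of the base.
    obtain ⟨P, Q, hPQ⟩ : ∃ P Q : ι → ℝ, ∀ t, f.coord t x = 0 →
        f.coord t = P t • e.coord k + Q t • e.coord j :=
      ⟨fun t ↦ f.coord t (e k), fun t ↦ f.coord t (e j), fun t ↦ hplane _ (hf.coord_mem t)⟩
    have hi' := hPQ i hi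
    have hl' := hPQ l (hvan l hnl)
    have hm' := hPQ m (hvan m hnm)
    have hdet : (P l * Q m - P m * Q l) • f.coord i + (P m * Q i - P i * Q m) • f.coord l +
        (P i * Q l - P l * Q i) • f.coord m = 0 := by
      rw [hi', hl', hm']; module
    have hdet' : P l * Q m - P m * Q l = 0 := by
      simpa [Finsupp.single_eq_of_ne hne.1, Finsupp.single_eq_of_ne hne.2,
        Finsupp.single_eq_of_ne hne.1.symm, Finsupp.single_eq_of_ne hne.2.symm] using
        congrArg (fun g ↦ g (f i)) hdet
    have hP : P m • f.coord l - P l • f.coord m = 0 := by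
      have : P m • f.coord l - P l • f.coord m = -(P l * Q m - P m * Q l) • e.coord j := by
        rw [hl', hm']; module
      rw [this, hdet', neg_zero, zero_smul]
    have hQ : Q m • f.coord l - Q l • f.coord m = 0 := by
      have : Q m • f.coord l - Q l • f.coord m = (P l * Q m - P m * Q l) • e.coord k := by
        rw [hl', hm']; module
      rw [this, hdet', zero_smul]
    have hPm : P m = 0 := by
      simpa [Finsupp.single_eq_of_ne hml, Finsupp.single_eq_of_ne hml.symm] using
        congrArg (fun g ↦ g (f l)) hP
    have hQm : Q m = 0 := by
      simpa [Finsupp.single_eq_of_ne hml, Finsupp.single_eq_of_ne hml.symm] using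
        congrArg (fun g ↦ g (f l)) hQ
    have := congrArg (fun g ↦ g (f m)) hm'
    simp [hPm, hQm] at this
  have hcomb : ∀ ρ ∈ R, ρ x = 0 →
      ∃ s t : ℤ, ρ = (s : ℝ) • f.coord l + (t : ℝ) • f.coord m := by
    intro ρ hρ hρx
    obtain ⟨s, hs⟩ := hR.exists_int hw hf hρ l
    obtain ⟨t, ht⟩ := hR.exists_int hw hf hρ m
    refine ⟨s, t, f.ext fun i ↦ ?_⟩
    by_cases hi : i = l
    · subst hi; simp [hs, Finsupp.single_eq_of_ne hml]
    by_cases hi' : i = m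
    · subst hi'; simp [ht, Finsupp.single_eq_of_ne hml.symm]
    have := (hR.apply_eq_zero_or_coord_eq_zero hw hf hxw hρ hρx i).resolve_right fun h ↦ by
      rcases honly i h with h | h <;> contradiction
    simp [this, hi, hi']
  obtain ⟨hlx, hmx⟩ := And.intro (hvan l hnl) (hvan m hnm)
  refine hR.exists_add_of_dual_pair (x := x) hα _ (p := f l) (q := f m) (a := n l) (b := n m) rfl
    (Nat.pos_of_ne_zero hnl) (Nat.pos_of_ne_zero hnm) (hf.coord_mem l) (hf.coord_mem m) hlx hmx
    ((hw₀ _ (hf.coord_mem l) hlx).1 (hf.coord_pos l))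
    ((hw₀ _ (hf.coord_mem m) hmx).1 (hf.coord_pos m)) (by simp)
    (by simp [Finsupp.single_eq_of_ne hml.symm]) (by simp [Finsupp.single_eq_of_ne hml]) (by simp)
    hcomb ?_
  refine f.ext fun i ↦ ?_
  by_cases hi : i = l
  · subst hi; simp [hn, Finsupp.single_eq_of_ne hml]
  by_cases hi' : i = m
  · subst hi'; simp [hn, Finsupp.single_eq_of_ne hml.symm]
  have : n i = 0 := by
    by_contra h
    rcases honly i (hvan i h) with h | h <;> contradiction
  simp [hn, this, hi, hi']

/-- A form in `R` that is positive at `v` and not in the base at `v` is the sum of two forms in `R`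
that are positive at `v`. -/
theorem exists_add (hR : IsIntegralSystem ι R) {v : V} {e : Basis ι ℝ V}
    (hv : ∀ ρ ∈ R, ρ v ≠ 0) (he : IsDualBase R v e) {α : Dual ℝ V} (hα : α ∈ R) (hαv : 0 < α v)
    (hne : ∀ i, e.coord i ≠ α) : ∃ β ∈ R, 0 < β v ∧ ∃ γ ∈ R, 0 < γ v ∧ α = β + γ := by
  obtain ⟨w, hw, f, hf, k, hk⟩ := hR.exists_coord_eq hα
  refine (hR.exists_coord_eq_or_exists_add_of_coord_eq hv he hα hαv _ rfl hw hf hk).resolve_left ?_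
  rintro ⟨i, hi⟩
  exact hne i hi

end IsIntegralSystem
end Abstract

/-! ### Chambers and roots of a simplicial arrangement -/

section RootSet

variable {r : ℕ} {A : Set (Submodule ℝ (Fin r → ℝ))} {R : Set (Dual ℝ (Fin r → ℝ))}

namespace IsRootSet

theorem ker_mem (hR : IsRootSet A R) {ρ : Dual ℝ (Fin r → ℝ)} (hρ : ρ ∈ R) :
    LinearMap.ker ρ ∈ A := by
  obtain ⟨x, hx, rfl⟩ := hR
  obtain ⟨H, hH, rfl | rfl⟩ := hρ
  · rwa [hx H hH]
  · rwa [LinearMap.ker_neg, hx H hH]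

theorem exists_ker_eq (hR : IsRootSet A R) {H : Submodule ℝ (Fin r → ℝ)} (hH : H ∈ A) :
    ∃ ρ ∈ R, LinearMap.ker ρ = H := by
  obtain ⟨x, hx, rfl⟩ := hR
  exact ⟨x H, ⟨H, hH, .inl rfl⟩, hx H hH⟩

theorem neg_mem (hR : IsRootSet A R) (ρ : Dual ℝ (Fin r → ℝ)) (hρ : ρ ∈ R) : -ρ ∈ R := by
  obtain ⟨x, hx, rfl⟩ := hR
  obtain ⟨H, hH, rfl | rfl⟩ := hρ
  · exact ⟨H, hH, .inr rfl⟩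
  · exact ⟨H, hH, .inl (neg_neg _)⟩

theorem finite (hA : A.Finite) (hR : IsRootSet A R) : R.Finite := by
  obtain ⟨x, hx, rfl⟩ := hR
  refine ((hA.image x).union (hA.image fun H ↦ -x H)).subset ?_
  rintro α ⟨H, hH, rfl | rfl⟩
  · exact .inl ⟨H, hH, rfl⟩
  · exact .inr ⟨H, hH, rfl⟩

theorem eq_or_eq_neg (hR : IsRootSet A R) {ρ σ : Dual ℝ (Fin r → ℝ)} (hρ : ρ ∈ R) (hσ : σ ∈ R)
    (h : LinearMap.ker σ = LinearMap.ker ρ) : σ = ρ ∨ σ = -ρ := by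
  obtain ⟨x, hx, rfl⟩ := hR
  obtain ⟨H, hH, hρ⟩ := hρ
  obtain ⟨H', hH', hσ⟩ := hσ
  have h1 : LinearMap.ker ρ = H := by rcases hρ with rfl | rfl <;> simp [hx H hH]
  have h2 : LinearMap.ker σ = H' := by rcases hσ with rfl | rfl <;> simp [hx H' hH']
  obtain rfl : H = H' := by rw [← h1, ← h2, h]
  rcases hρ with rfl | rfl <;> rcases hσ with rfl | rfl <;> simp

theorem zero_notMem (hA : IsSimplicial A) (hR : IsRootSet A R) :
    (0 : Dual ℝ (Fin r → ℝ)) ∉ R := by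
  intro h
  have := hA.hyperplane _ (hR.ker_mem h)
  rw [LinearMap.ker_zero, finrank_top, finrank_fin_fun] at this
  omega

theorem reduced (hA : IsSimplicial A) (hR : IsRootSet A R) (ρ : Dual ℝ (Fin r → ℝ)) (hρ : ρ ∈ R)
    (c : ℝ) (hc : c • ρ ∈ R) : c = 1 ∨ c = -1 := by
  have hρ0 : ρ ≠ 0 := fun h ↦ hR.zero_notMem hA (h ▸ hρ)
  have hc0 : c ≠ 0 := by
    rintro rfl
    exact hR.zero_notMem hA (by simpa using hc)
  rcases hR.eq_or_eq_neg hρ hc (LinearMap.ker_smul ρ c hc0) with h | h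
  · left
    exact smul_left_injective ℝ hρ0 (by simpa using h)
  · right
    exact smul_left_injective ℝ hρ0 (by simpa using h)

theorem mem_complement_iff (hR : IsRootSet A R) {v : Fin r → ℝ} :
    v ∈ complement A ↔ ∀ ρ ∈ R, ρ v ≠ 0 := by
  simp only [complement, Set.mem_compl_iff, Set.mem_iUnion, not_exists, SetLike.mem_coe]
  constructor
  · exact fun h ρ hρ h0 ↦ h _ (hR.ker_mem hρ) h0
  · intro h H hH hv
    obtain ⟨ρ, hρ, rfl⟩ := hR.exists_ker_eq hH
    exact h ρ hρ hv

/-- A root has no zero on the connected chamber, so the intermediate value theorem forbids a change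
of sign. -/
theorem pos_of_mem_chamber (hR : IsRootSet A R) {v w : Fin r → ℝ}
    (hw : w ∈ connectedComponentIn (complement A) v) {ρ : Dual ℝ (Fin r → ℝ)} (hρ : ρ ∈ R)
    (hρv : 0 < ρ v) : 0 < ρ w := by
  by_contra h
  have hv : v ∈ connectedComponentIn (complement A) v :=
    mem_connectedComponentIn (connectedComponentIn_nonempty_iff.1 ⟨w, hw⟩)
  have hc : Continuous ρ := ρ.continuous_of_finiteDimensional
  obtain ⟨z, hz, hz0⟩ := isPreconnected_connectedComponentIn.intermediate_value hw hv
    hc.continuousOn ⟨not_lt.1 h, hρv.le⟩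
  exact hR.mem_complement_iff.1 (connectedComponentIn_subset _ _ hz) ρ hρ hz0

end IsRootSet

theorem mem_closure_cone (b : Basis (Fin r) ℝ (Fin r → ℝ)) {w : Fin r → ℝ}
    (hw : ∀ i, 0 ≤ b.coord i w) : w ∈ closure {u | ∀ i, 0 < b.coord i u} := by
  have hc : Continuous fun t : ℝ ↦ w + t • ∑ i, b i := by fun_prop
  have ht := (hc.tendsto 0).mono_left (nhdsWithin_le_nhds (s := Set.Ioi 0))
  simp only [zero_smul, add_zero] at ht
  refine mem_closure_of_tendsto ht ?_
  filter_upwards [self_mem_nhdsWithin] with t (ht : 0 < t) i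
  have : b.coord i (∑ i, b i) = 1 := by simp [Finsupp.single_apply]
  rw [map_add, map_smul, this, smul_eq_mul, mul_one]
  linarith [hw i]

theorem coord_nonneg_of_mem_closure (b : Basis (Fin r) ℝ (Fin r → ℝ)) {w : Fin r → ℝ}
    (hw : w ∈ closure {u | ∀ i, 0 < b.coord i u}) (i : Fin r) : 0 ≤ b.coord i w := by
  have hc : Continuous (b.coord i) := (b.coord i).continuous_of_finiteDimensional
  have : IsClosed {u | 0 ≤ b.coord i u} := isClosed_le continuous_const hc
  exact closure_minimal (fun u hu ↦ (hu i).le) this hw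

theorem apply_basis_nonneg (b : Basis (Fin r) ℝ (Fin r → ℝ)) {ρ : Dual ℝ (Fin r → ℝ)}
    (h : ∀ u, (∀ i, 0 < b.coord i u) → 0 ≤ ρ u) (i : Fin r) : 0 ≤ ρ (b i) := by
  have hc : Continuous ρ := ρ.continuous_of_finiteDimensional
  have hcl : IsClosed {u | 0 ≤ ρ u} := isClosed_le continuous_const hc
  refine closure_minimal (s := {u | ∀ i, 0 < b.coord i u}) (fun u hu ↦ h u hu) hcl
    (mem_closure_cone b fun j ↦ ?_)
  simp only [Basis.coord_apply, Basis.repr_self, Finsupp.single_apply]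
  split_ifs <;> norm_num

/-- A chamber is the positive cone of a basis whose coordinate forms belong to the root set. -/
theorem exists_basis_chamber (hA : IsSimplicial A) (hR : IsRootSet A R) {v : Fin r → ℝ}
    (hv : v ∈ complement A) : ∃ e : Basis (Fin r) ℝ (Fin r → ℝ),
      connectedComponentIn (complement A) v = {u | ∀ i, 0 < e.coord i u} ∧
      ∀ i, e.coord i ∈ R := by
  obtain ⟨b, hb⟩ := hA.simplicial _ ⟨v, hv, rfl⟩
  have hK : connectedComponentIn (complement A) v = {u | ∀ i, 0 < b.coord i u} := by
    rw [hb]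
    ext u
    constructor
    · rintro ⟨a, ha, rfl⟩ i
      simpa [Finsupp.single_apply] using ha i
    · intro hu
      exact ⟨fun i ↦ b.coord i u, hu, (b.sum_repr u).symm⟩
  have hwall : ∀ i, ∃ c : ℝ, 0 < c ∧ c • b.coord i ∈ R := by
    intro i
    -- A relative interior point of the facet opposite `b i`. It lies on some hyperplane of the
    -- arrangement, as otherwise adjoining it would enlarge the chamber; the root of that hyperplane
    -- is proportional to `b.coord i`.
    set f : Fin r → ℝ := ∑ j, b j - b i with hf
    have hfj : ∀ j, b.coord j f = if j = i then 0 else 1 := by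
      intro j
      have : b.coord j (∑ i, b i) = 1 := by simp [Finsupp.single_apply]
      rw [hf, map_sub, this]
      by_cases h : j = i
      · subst h; simp
      · simp [h]
    have hfcl : f ∈ closure (connectedComponentIn (complement A) v) := by
      rw [hK]
      exact mem_closure_cone b fun j ↦ by rw [hfj]; split_ifs <;> norm_num
    have hfA : f ∉ complement A := by
      intro h
      have hpre : IsPreconnected (insert f (connectedComponentIn (complement A) v)) :=
        isPreconnected_connectedComponentIn.subset_closure (Set.subset_insert _ _)
          (Set.insert_subset hfcl subset_closure)
      have hsub := hpre.subset_connectedComponentIn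
        (Set.mem_insert_of_mem _ (mem_connectedComponentIn hv))
        (Set.insert_subset h (connectedComponentIn_subset _ _))
      have := hsub (Set.mem_insert _ _)
      rw [hK] at this
      have := this i
      rw [hfj] at this
      simp at this
    rw [hR.mem_complement_iff] at hfA
    push Not at hfA
    obtain ⟨ρ, hρ, hρf⟩ := hfA
    wlog hρv : 0 < ρ v generalizing ρ
    · exact this (-ρ) (hR.neg_mem ρ hρ) (by simp [hρf])
        (by simpa using lt_of_le_of_ne (not_lt.1 hρv) (hR.mem_complement_iff.1 hv ρ hρ))
    have hnn : ∀ j, 0 ≤ ρ (b j) := apply_basis_nonneg b fun u hu ↦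
      (hR.pos_of_mem_chamber (by rw [hK]; exact hu) hρ hρv).le
    have h0 : ∀ j, j ≠ i → ρ (b j) = 0 := by
      intro j hj
      rw [apply_eq_sum_coord b, Finset.sum_eq_zero_iff_of_nonneg] at hρf
      · have := hρf j (Finset.mem_univ j)
        rw [hfj, if_neg hj, mul_one] at this
        exact this
      · intro k _
        rw [hfj]
        split_ifs <;> simp [hnn k]
    have hρeq := eq_smul_coord b h0
    refine ⟨ρ (b i), lt_of_le_of_ne (hnn i) fun h ↦ ?_, hρeq ▸ hρ⟩
    rw [← h, zero_smul] at hρeq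
    exact hR.zero_notMem hA (hρeq ▸ hρ)
  choose c hc hcR using hwall
  -- Dividing the basis vectors by `c i` multiplies the coordinate forms by `c i`, which makes them
  -- roots.
  set e := b.isUnitSMul (w := fun i ↦ (c i)⁻¹) fun i ↦ (inv_pos.2 (hc i)).ne'.isUnit with he
  have hcoord : ∀ i, e.coord i = c i • b.coord i := by
    intro i
    refine e.ext fun j ↦ ?_
    rw [Basis.coord_apply, Basis.repr_self, LinearMap.smul_apply, he, Basis.isUnitSMul_apply,
      map_smul, Basis.coord_apply, Basis.repr_self]
    by_cases h : j = i
    · subst h; simp [(hc j).ne']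
    · simp [h]
  refine ⟨e, ?_, fun i ↦ by rw [hcoord]; exact hcR i⟩
  rw [hK]
  ext u
  simp only [Set.mem_ofPred_eq]
  refine forall_congr' fun i ↦ ?_
  rw [hcoord, LinearMap.smul_apply, smul_eq_mul, mul_pos_iff_of_pos_left (hc i)]

theorem finrank_ker_coord_add_one (e : Basis (Fin r) ℝ (Fin r → ℝ)) (i : Fin r) :
    finrank ℝ (LinearMap.ker (e.coord i)) + 1 = r := by
  have hne : e.coord i ≠ 0 := fun h ↦ by
    have := congrArg (fun f ↦ f (e i)) h
    simp at this
  have := Module.Dual.finrank_ker_add_one_of_ne_zero hne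
  simpa using this

/-- The simple roots of a chamber are the coordinate forms of the basis spanning it. -/
theorem simpleRoots_eq_range (hA : IsSimplicial A) (hR : IsRootSet A R)
    {e : Basis (Fin r) ℝ (Fin r → ℝ)} (heR : ∀ i, e.coord i ∈ R) :
    simpleRoots A R {u | ∀ i, 0 < e.coord i u} = Set.range e.coord := by
  ext α
  constructor
  · rintro ⟨hα, ⟨-, hdim⟩, hpos⟩
    have hnn : ∀ i, 0 ≤ α (e i) := apply_basis_nonneg e fun u hu ↦ by
      have : u ∈ halfSpace α ∩ {u | ∀ i, 0 < e.coord i u} := by rw [hpos]; exact hu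
      exact this.1
    obtain ⟨i, hi⟩ : ∃ i, α (e i) ≠ 0 := by
      by_contra! h
      have : α = 0 := e.ext fun i ↦ by simp [h i]
      exact hR.zero_notMem hA (this ▸ hα)
    -- `S` lies in both `ker α` and `ker (e.coord i)` and has the dimension of each, so the two
    -- kernels agree.
    set S := Submodule.span ℝ
      ((LinearMap.ker α : Set (Fin r → ℝ)) ∩ closure {u | ∀ i, 0 < e.coord i u}) with hS
    have h1 : S ≤ LinearMap.ker α := Submodule.span_le.2 fun u hu ↦ hu.1
    have h2 : S ≤ LinearMap.ker (e.coord i) := by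
      refine Submodule.span_le.2 fun u hu ↦ ?_
      have hu0 : α u = 0 := hu.1
      rw [apply_eq_sum_coord e, Finset.sum_eq_zero_iff_of_nonneg fun j _ ↦
        mul_nonneg (hnn j) (coord_nonneg_of_mem_closure e hu.2 j)] at hu0
      exact (mul_eq_zero.1 (hu0 i (Finset.mem_univ i))).resolve_left hi
    have h1' := Submodule.eq_of_le_of_finrank_eq h1
      (by have := hA.hyperplane _ (hR.ker_mem hα); omega)
    have h2' := Submodule.eq_of_le_of_finrank_eq h2
      (by have := finrank_ker_coord_add_one e i; omega)
    refine ⟨i, ?_⟩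
    rcases hR.eq_or_eq_neg (heR i) hα (h1'.symm.trans h2') with h | h
    · exact h.symm
    · have := hnn i
      rw [h] at this
      norm_num at this
  · rintro ⟨i, rfl⟩
    refine ⟨heR i, ⟨hR.ker_mem (heR i), ?_⟩, ?_⟩
    · rw [show Submodule.span ℝ ((LinearMap.ker (e.coord i) : Set (Fin r → ℝ)) ∩
        closure {u | ∀ i, 0 < e.coord i u}) = LinearMap.ker (e.coord i) from ?_]
      · exact finrank_ker_coord_add_one e i
      refine le_antisymm (Submodule.span_le.2 fun u hu ↦ hu.1) fun u hu ↦ ?_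
      rw [← e.sum_repr u]
      refine Submodule.sum_mem _ fun j _ ↦ ?_
      by_cases hj : j = i
      · subst hj
        have : e.repr u j = 0 := hu
        rw [this, zero_smul]
        exact Submodule.zero_mem _
      · refine Submodule.smul_mem _ _ (Submodule.subset_span ⟨?_, mem_closure_cone e fun k ↦ ?_⟩)
        · simp [hj]
        · simp only [Basis.coord_apply, Basis.repr_self, Finsupp.single_apply]
          split_ifs <;> norm_num
    · exact Set.inter_eq_right.2 fun u hu ↦ (hu i).le

/-- The positive roots of the chamber of `v` are the roots that are positive at `v`. -/
theorem mem_positiveRoots_iff (hA : IsSimplicial A) (hR : IsRootSet A R) {v : Fin r → ℝ}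
    (hv : v ∈ complement A) {ρ : Dual ℝ (Fin r → ℝ)} :
    ρ ∈ positiveRoots A R (connectedComponentIn (complement A) v) ↔ ρ ∈ R ∧ 0 < ρ v := by
  obtain ⟨e, hK, heR⟩ := exists_basis_chamber hA hR hv
  have hvK : ∀ i, 0 < e.coord i v := by
    have := mem_connectedComponentIn hv
    rwa [hK] at this
  rw [positiveRoots, hK, simpleRoots_eq_range hA hR heR]
  refine and_congr_right fun hρ ↦ ⟨fun h ↦ ?_, fun h ↦ ?_⟩
  · refine lt_of_le_of_ne ?_ (hR.mem_complement_iff.1 hv ρ hρ).symm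
    refine Submodule.span_induction (p := fun ρ _ ↦ 0 ≤ ρ v) ?_ ?_ ?_ ?_ h
    · rintro _ ⟨i, rfl⟩
      exact (hvK i).le
    · simp
    · intro x y _ _ hx hy
      simpa using add_nonneg hx hy
    · intro a x _ hx
      exact mul_nonneg a.2 hx
  · have hnn : ∀ i, 0 ≤ ρ (e i) := apply_basis_nonneg e fun u hu ↦
      (hR.pos_of_mem_chamber (by rw [hK]; exact hu) hρ h).le
    rw [← e.sum_dual_apply_smul_coord ρ]
    refine Submodule.sum_mem _ fun i _ ↦ ?_
    exact Submodule.smul_mem _ (⟨ρ (e i), hnn i⟩ : NNReal) (Submodule.subset_span ⟨i, rfl⟩)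

/-! ### The two implications -/

theorem IsCrystallographic.isAdditive (hA : IsSimplicial A) (hR : IsRootSet A R)
    (hcr : IsCrystallographic A R) : IsAdditive A R := by
  have hbase : ∀ v ∈ complement A, ∃ e : Basis (Fin r) ℝ (Fin r → ℝ), IsDualBase R v e ∧
      simpleRoots A R (connectedComponentIn (complement A) v) = Set.range e.coord := by
    intro v hv
    obtain ⟨e, hK, heR⟩ := exists_basis_chamber hA hR hv
    have hS := simpleRoots_eq_range hA hR heR
    rw [← hK] at hS
    refine ⟨e, ⟨heR, ?_, fun ρ hρ hρv i ↦ ?_⟩, hS⟩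
    · have := mem_connectedComponentIn hv
      rwa [hK] at this
    · have hnn : 0 ≤ ρ (e i) := apply_basis_nonneg e (fun u hu ↦
        (hR.pos_of_mem_chamber (by rw [hK]; exact hu) hρ hρv).le) i
      have hmem := hcr _ ⟨v, hv, rfl⟩ hρ
      rw [hS] at hmem
      obtain ⟨n, hn⟩ : ∃ n : ℤ, ρ (e i) = n := by
        refine Submodule.span_induction 
          (p := fun (ρ : Dual ℝ (Fin r → ℝ)) _ ↦ ∃ n : ℤ, ρ (e i) = n) ?_ ?_ ?_ ?_ hmem
        · rintro _ ⟨j, rfl⟩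
          by_cases h : i = j
          · exact ⟨1, by simp [h]⟩
          · exact ⟨0, by simp [h]⟩
        · exact ⟨0, by simp⟩
        · rintro x y _ _ ⟨m, hm⟩ ⟨n, hn⟩
          exact ⟨m + n, by simp [hm, hn]⟩
        · rintro a x _ ⟨m, hm⟩
          exact ⟨a * m, by simp [hm]⟩
      rw [hn] at hnn
      lift n to ℕ using (by exact_mod_cast hnn)
      exact ⟨n, by simpa using hn⟩
  have hsys : IsIntegralSystem (Fin r) R :=
    { finite := hR.finite hA.finite
      neg_mem := hR.neg_mem
      zero_notMem := hR.zero_notMem hA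
      reduced := hR.reduced hA
      exists_dualBase := fun v hv ↦ by
        obtain ⟨e, he, -⟩ := hbase v (hR.mem_complement_iff.2 hv)
        exact ⟨e, he⟩ }
  rintro K ⟨v, hv, rfl⟩ α ⟨hα, hα'⟩
  obtain ⟨e, he, hS⟩ := hbase v hv
  rw [mem_positiveRoots_iff hA hR hv] at hα
  rw [hS] at hα'
  obtain ⟨β, hβ, hβv, γ, hγ, hγv, h⟩ := hsys.exists_add (hR.mem_complement_iff.1 hv) he hα.1 hα.2
    fun i hi ↦ hα' ⟨i, hi⟩
  exact ⟨β, (mem_positiveRoots_iff hA hR hv).2 ⟨hβ, hβv⟩, γ,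
    (mem_positiveRoots_iff hA hR hv).2 ⟨hγ, hγv⟩, h⟩

theorem IsAdditive.isCrystallographic (hA : IsSimplicial A) (hR : IsRootSet A R)
    (had : IsAdditive A R) : IsCrystallographic A R := by
  rintro K ⟨v, hv, rfl⟩
  have hfin : (positiveRoots A R (connectedComponentIn (complement A) v)).Finite :=
    (hR.finite hA.finite).subset fun ρ h ↦ h.1
  have hpos : ∀ ρ ∈ positiveRoots A R (connectedComponentIn (complement A) v),
      ρ ∈ Submodule.span ℤ (simpleRoots A R (connectedComponentIn (complement A) v)) := by
    intro ρ hρ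
    -- Finiteness makes the order by value at `v` well-founded; both summands of a root are positive
    -- at `v`, hence smaller.
    refine (hfin.wellFoundedOn (r := fun ρ σ ↦ ρ v < σ v)).induction hρ fun ρ hρ ih ↦ ?_
    by_cases hs : ρ ∈ simpleRoots A R (connectedComponentIn (complement A) v)
    · exact Submodule.subset_span hs
    obtain ⟨β, hβ, γ, hγ, rfl⟩ := had _ ⟨v, hv, rfl⟩ ρ ⟨hρ, hs⟩
    have hβv := ((mem_positiveRoots_iff hA hR hv).1 hβ).2
    have hγv := ((mem_positiveRoots_iff hA hR hv).1 hγ).2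
    exact Submodule.add_mem _ (ih β hβ (by simpa using hγv)) (ih γ hγ (by simpa using hβv))
  intro ρ hρ
  rcases lt_or_gt_of_ne (hR.mem_complement_iff.1 hv ρ hρ) with h | h
  · rw [SetLike.mem_coe, ← Submodule.neg_mem_iff]
    exact hpos _ ((mem_positiveRoots_iff hA hR hv).2 ⟨hR.neg_mem ρ hρ, by simpa using h⟩)
  · exact hpos _ ((mem_positiveRoots_iff hA hR hv).2 ⟨hρ, h⟩)

end RootSet
end Arrangement

theorem mainTheorem2 {r : ℕ} (A : Set (Submodule ℝ (Fin r → ℝ)))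
    (R : Set (Module.Dual ℝ (Fin r → ℝ)))
    (hA : Arrangement.IsSimplicial A) (hR : Arrangement.IsRootSet A R) :
    Arrangement.IsCrystallographic A R ↔ Arrangement.IsAdditive A R :=
  ⟨fun h ↦ h.isAdditive hA hR, fun h ↦ h.isCrystallographic hA hR⟩
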